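/- Let $n\ge 1$ and let $\Phi,\Psi$ be bi-stochastic completely positive super-operators on the complex $n\times n$ matrices $M_n(\mathbb C)$, i.e. completely positive linear maps $M_n(\mathbb C)\to M_n(\mathbb C)$ that are trace preserving and unital. Let $U$ be an $n\times n$ complex unitary matrix. Write $\operatorname{vec}(A)=\sum_{i,j}A_{ij}\,|i\rangle\otimes|j\rangle$ for $A\in M_n(\mathbb C)$, let $S(\rho)=-\operatorname{Tr}(\rho\log\rho)$ be the von Neumann entropy, and let $$S^{\mathrm{map}}(\Phi)=S\Big(\tfrac1n(\Phi\otimes \mathrm{id})\big(\operatorname{vec}(\mathbb 1)\operatorname{vec}(\mathbb 1)^\dagger\big)\Big)$$ be the map entropy. Then, for the maximally entangled state $\frac1{\sqrt n}\operatorname{vec}(U)$, $$\max\{S^{\mathrm{map}}(\Phi),S^{\mathrm{map}}(\Psi)\}\;\le\; S\Big((\Phi\otimes\Psi)\big(\tfrac1n\operatorname{vec}(U)\operatorname{vec}(U)^\dagger\big)\Big)\;\le\; S^{\mathrm{map}}(\Phi)+S^{\mathrm{map}}(\Psi).$$ -/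

import Mathlib

open scoped Kronecker ComplexOrder

namespace QOp

/-- A super-operator on the operators on `ℂ^ι`, i.e. a linear map on complex matrices. -/
abbrev SuperOp (ι : Type*) : Type _ := Matrix ι ι ℂ →ₗ[ℂ] Matrix ι ι ℂ

/-- The tensor product `Φ ⊗ Ψ` of two super-operators: the linear map given on matrix units by
`E_{ij} ⊗ E_{kl} ↦ Φ(E_{ij}) ⊗ Ψ(E_{kl})`. -/
noncomputable def tensor {ι κ : Type*} [Fintype ι] [DecidableEq ι] [Fintype κ] [DecidableEq κ]
    (Φ : SuperOp ι) (Ψ : SuperOp κ) : SuperOp (ι × κ) where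
  toFun X := ∑ i, ∑ j, ∑ k, ∑ l,
    X (i, k) (j, l) • (Φ (Matrix.single i j 1) ⊗ₖ Ψ (Matrix.single k l 1))
  map_add' X Y := by
    simp only [Matrix.add_apply, add_smul, Finset.sum_add_distrib]
  map_smul' c X := by
    simp only [Matrix.smul_apply, smul_eq_mul, mul_smul, Finset.smul_sum, RingHom.id_apply]

/-- The defining property of the tensor product: `(Φ ⊗ Ψ)(A ⊗ B) = Φ(A) ⊗ Ψ(B)`. -/
theorem tensor_kronecker {ι κ : Type*} [Fintype ι] [DecidableEq ι] [Fintype κ] [DecidableEq κ]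
    (Φ : SuperOp ι) (Ψ : SuperOp κ) (A : Matrix ι ι ℂ) (B : Matrix κ κ ℂ) :
    tensor Φ Ψ (A ⊗ₖ B) = Φ A ⊗ₖ Ψ B := by
  have hA : Φ A = ∑ i, ∑ j, A i j • Φ (Matrix.single i j 1) := by
    conv_lhs => rw [Matrix.matrix_eq_sum_single A]
    simp only [map_sum, ← map_smul, Matrix.smul_single, smul_eq_mul, mul_one]
  have hB : Ψ B = ∑ k, ∑ l, B k l • Ψ (Matrix.single k l 1) := by
    conv_lhs => rw [Matrix.matrix_eq_sum_single B]
    simp only [map_sum, ← map_smul, Matrix.smul_single, smul_eq_mul, mul_one]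
  ext ⟨a, b⟩ ⟨c, d⟩
  rw [hA, hB]
  simp only [tensor, LinearMap.coe_mk, AddHom.coe_mk, Matrix.sum_apply, Matrix.smul_apply,
    Matrix.kroneckerMap_apply, smul_eq_mul, Finset.sum_mul]
  refine Finset.sum_congr rfl fun i _ => Finset.sum_congr rfl fun j _ => ?_
  rw [Finset.mul_sum]
  refine Finset.sum_congr rfl fun k _ => ?_
  rw [Finset.mul_sum]
  refine Finset.sum_congr rfl fun l _ => ?_
  ring

/-- Complete positivity: `Φ ⊗ id_k` sends positive semidefinite matrices to positive semidefinite
matrices, for every `k`. -/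
def IsCP {ι : Type*} [Fintype ι] [DecidableEq ι] (Φ : SuperOp ι) : Prop :=
  ∀ (k : ℕ) (X : Matrix (ι × Fin k) (ι × Fin k) ℂ), X.PosSemidef →
    (tensor Φ (LinearMap.id : SuperOp (Fin k)) X).PosSemidef

/-- A bi-stochastic CP super-operator: completely positive, trace preserving and unital. -/
structure IsBistochastic {ι : Type*} [Fintype ι] [DecidableEq ι] (Φ : SuperOp ι) : Prop where
  isCP : IsCP Φ
  trace_preserving : ∀ X : Matrix ι ι ℂ, (Φ X).trace = X.trace
  unital : Φ 1 = 1

/-- The vectorization `vec(A) = ∑_{m,μ} A_{mμ} |m⟩ ⊗ |μ⟩`. -/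
def vec {ι κ : Type*} (A : Matrix ι κ ℂ) : ι × κ → ℂ := fun p => A p.1 p.2

/-- The rank-one operator `|ψ⟩⟨ψ|`. -/
def ketbra {ι : Type*} (ψ : ι → ℂ) : Matrix ι ι ℂ := Matrix.vecMulVec ψ (star ψ)

/-- The von Neumann entropy `S(ρ) = -Tr(ρ log ρ)`. -/
noncomputable def vonNeumannEntropy {ι : Type*} [Fintype ι] [DecidableEq ι]
    (ρ : Matrix ι ι ℂ) : ℝ :=
  -(Matrix.trace (ρ * cfc Real.log ρ)).re

/-- The dynamical (Choi) matrix `J(Φ) = (Φ ⊗ id)(vec(1) vec(1)†)`. -/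
noncomputable def dynamicalMatrix {n : ℕ} (Φ : SuperOp (Fin n)) :
    Matrix (Fin n × Fin n) (Fin n × Fin n) ℂ :=
  tensor Φ (LinearMap.id : SuperOp (Fin n)) (ketbra (vec (1 : Matrix (Fin n) (Fin n) ℂ)))

/-- The map entropy: the von Neumann entropy of the Jamiołkowski state `J(Φ) / n`. -/
noncomputable def mapEntropy {n : ℕ} (Φ : SuperOp (Fin n)) : ℝ :=
  vonNeumannEntropy ((n : ℂ)⁻¹ • dynamicalMatrix Φ)

/-- The maximally entangled unit vector `vec(U) / √n`. -/
noncomputable def maxEntangled {n : ℕ} (U : Matrix (Fin n) (Fin n) ℂ) : Fin n × Fin n → ℂ :=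
  ((Real.sqrt n : ℝ) : ℂ)⁻¹ • vec U

end QOp

/-!
Kraus operators `Kₐ` of `Φ` and `Lᵦ` of `Ψ` turn the output on a maximally entangled state into
`σ = n⁻¹ ∑ₐᵦ |vec (Kₐ U Lᵦᵀ)⟩⟨vec (Kₐ U Lᵦᵀ)|`, because `(A ⊗ B) vec X = vec (A X Bᵀ)`.

*Lower bound.* Since `vec (Kₐ U Lᵦᵀ) = (1 ⊗ Lᵦ Uᵀ) vec Kₐ`, the state `σ` is the image of the
Jamiołkowski state `n⁻¹ ∑ₐ |vec Kₐ⟩⟨vec Kₐ|` of `Φ` under the operation with Kraus operators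
`1 ⊗ Lᵦ Uᵀ`. That operation is bistochastic, so it does not decrease the entropy
(`vonNeumannEntropy_le_of_bistochastic`). The bound for `Ψ` follows by exchanging the two tensor
factors, which replaces `U` by `Uᵀ` (`vonNeumannEntropy_tensor_swap_le`).

*Upper bound.* The entropy of a mixture of pure states is at most the Shannon entropy of its
weights (`vonNeumannEntropy_mul_conjTranspose_le`), so `S(σ) ≤ H(p)` with
`p a b = n⁻¹ ‖vec (Kₐ U Lᵦᵀ)‖²`. As `Φ` and `Ψ` preserve the trace and `U` is unitary, the marginals
of `p` are `n⁻¹ ‖vec Kₐ‖²` and `n⁻¹ ‖vec Lᵦ‖²`. If the Kraus operators are read off from the spectral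
decompositions of the dynamical matrices (`exists_kraus`), these marginals are the spectra of the
Jamiołkowski states, and classical subadditivity (`sum_negMulLog_le_add_marginals`) gives the bound.
Choosing the Kraus operators in this way makes the reduced states of the environment diagonal, which
is why the quantum form of subadditivity is not needed.

Both entropy comparisons rest on Jensen's inequality for `negMulLog`, applied to a substochastic
matrix relating two spectra (`sum_negMulLog_le_of_substochastic`).
-/

namespace QOp

open Matrix Real

/-! ### Scalar entropy inequalities -/

/-- Shannon entropy does not decrease under a matrix `B` whose row sums are at most one and whose
columns are normalized on the support of `μ`. Row sums below one are harmless in Jensen's inequality, since the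
missing weight can be put at `0`, where `negMulLog` vanishes. -/
theorem sum_negMulLog_le_of_substochastic {α β : Type*} [Fintype α] [Fintype β]
    (B : β → α → ℝ) (μ : α → ℝ) (hB : ∀ k a, 0 ≤ B k a) (hμ : ∀ a, 0 ≤ μ a)
    (hrow : ∀ k, ∑ a, B k a ≤ 1) (hcol : ∀ a, μ a ≠ 0 → ∑ k, B k a = 1) :
    ∑ a, negMulLog (μ a) ≤ ∑ k, negMulLog (∑ a, B k a * μ a) := by
  have hjensen : ∀ k, ∑ a, B k a * negMulLog (μ a) ≤ negMulLog (∑ a, B k a * μ a) := by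
    intro k
    have h := concaveOn_negMulLog.map_add_sum_le (t := Finset.univ) (w := B k) (p := μ)
      (v := 1 - ∑ a, B k a) (q := 0) (fun a _ => hB k a) (by ring)
      (fun a _ => hμ a) (by linarith [hrow k]) (by simp)
    simpa using h
  calc ∑ a, negMulLog (μ a) = ∑ a, ∑ k, B k a * negMulLog (μ a) := by
        refine Finset.sum_congr rfl fun a _ => ?_
        rw [← Finset.sum_mul]
        by_cases h : μ a = 0
        · simp [h]
        · rw [hcol a h, one_mul]
    _ = ∑ k, ∑ a, B k a * negMulLog (μ a) := Finset.sum_comm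
    _ ≤ _ := Finset.sum_le_sum fun k _ => hjensen k

/-- Subadditivity of the Shannon entropy. -/
theorem sum_negMulLog_le_add_marginals {α β : Type*} [Fintype α] [Fintype β]
    (p : α → β → ℝ) (hp : ∀ a b, 0 ≤ p a b) (hsum : ∑ a, ∑ b, p a b = 1) :
    ∑ a, ∑ b, negMulLog (p a b) ≤
      ∑ a, negMulLog (∑ b, p a b) + ∑ b, negMulLog (∑ a, p a b) := by
  set q : α → ℝ := fun a => ∑ b, p a b with hq
  set r : β → ℝ := fun b => ∑ a, p a b with hr
  have hq0 : ∀ a, 0 ≤ q a := fun a => Finset.sum_nonneg fun b _ => hp a b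
  have hr0 : ∀ b, 0 ≤ r b := fun b => Finset.sum_nonneg fun a _ => hp a b
  have hr1 : ∑ b, r b = 1 := by rw [← hsum, Finset.sum_comm]
  -- the tangent line bound `log x ≤ x - 1` at `x = q r / p`
  have key : ∀ a b, negMulLog (p a b) ≤
      -(p a b * log (q a)) - p a b * log (r b) + (q a * r b - p a b) := by
    intro a b
    rcases (hp a b).eq_or_lt with h | h
    · rw [← h]
      simpa using mul_nonneg (hq0 a) (hr0 b)
    · have hqa : 0 < q a :=
        h.trans_le (Finset.single_le_sum (f := fun b => p a b) (fun b _ => hp a b) (Finset.mem_univ b))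
      have hrb : 0 < r b :=
        h.trans_le (Finset.single_le_sum (f := fun a => p a b) (fun a _ => hp a b) (Finset.mem_univ a))
      have h1 := log_le_sub_one_of_pos (div_pos (mul_pos hqa hrb) h)
      rw [log_div (mul_pos hqa hrb).ne' h.ne', log_mul hqa.ne' hrb.ne'] at h1
      have h2 := mul_le_mul_of_nonneg_left h1 h.le
      have h3 : p a b * (q a * r b / p a b - 1) = q a * r b - p a b := by
        field_simp
      rw [h3] at h2
      rw [negMulLog]
      linarith
  calc ∑ a, ∑ b, negMulLog (p a b)
      ≤ ∑ a, ∑ b, (-(p a b * log (q a)) - p a b * log (r b) + (q a * r b - p a b)) :=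
        Finset.sum_le_sum fun a _ => Finset.sum_le_sum fun b _ => key a b
    _ = ∑ a, ∑ b, -(p a b * log (q a)) + ∑ b, ∑ a, -(p a b * log (r b))
          + ((∑ a, q a) * (∑ b, r b) - ∑ a, ∑ b, p a b) := by
        rw [Finset.sum_comm (f := fun b a => -(p a b * log (r b))), Finset.sum_mul_sum]
        simp only [← Finset.sum_add_distrib, ← Finset.sum_sub_distrib]
        refine Finset.sum_congr rfl fun a _ => Finset.sum_congr rfl fun b _ => by ring
    _ = _ := by
        rw [hr1, show ∑ a, q a = 1 from hsum]
        simp only [negMulLog, Finset.sum_neg_distrib, ← Finset.sum_mul, neg_mul]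
        rw [hq, hr]
        ring

/-! ### Entropy and eigenvalues -/

theorem vonNeumannEntropy_eq_sum_eigenvalues {m : Type*} [Fintype m] [DecidableEq m]
    {ρ : Matrix m m ℂ} (hρ : ρ.IsHermitian) :
    vonNeumannEntropy ρ = ∑ i, negMulLog (hρ.eigenvalues i) := by
  have hmul : ρ * cfc Real.log ρ = cfc (fun x => x * Real.log x) ρ := by
    have hfin : (spectrum ℝ ρ).Finite := finite_real_spectrum
    rw [cfc_mul (fun x => x) Real.log ρ (hfin.continuousOn _) (hfin.continuousOn _),
      cfc_id' ℝ ρ hρ.isSelfAdjoint]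
  rw [vonNeumannEntropy, hmul, hρ.cfc_eq, IsHermitian.cfc, Unitary.conjStarAlgAut_apply,
    trace_mul_comm, ← mul_assoc, Unitary.coe_star_mul_self, one_mul, trace_diagonal]
  simp [negMulLog, Complex.re_sum]

/-- A unitary diagonalization of a positive semidefinite matrix, together with the expression of
its entropy in terms of the eigenvalues. -/
theorem exists_diagonalization {m : Type*} [Fintype m] [DecidableEq m]
    {ρ : Matrix m m ℂ} (hρ : ρ.PosSemidef) :
    ∃ (V : Matrix m m ℂ) (μ : m → ℝ), (∀ i, 0 ≤ μ i) ∧ Vᴴ * V = 1 ∧ V * Vᴴ = 1 ∧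
      Vᴴ * ρ * V = diagonal (fun i => (μ i : ℂ)) ∧
      vonNeumannEntropy ρ = ∑ i, negMulLog (μ i) := by
  have h1 : (hρ.1.eigenvectorUnitary : Matrix m m ℂ)ᴴ * hρ.1.eigenvectorUnitary = 1 :=
    Unitary.coe_star_mul_self _
  refine ⟨hρ.1.eigenvectorUnitary, hρ.1.eigenvalues, hρ.eigenvalues_nonneg, h1,
    Unitary.coe_mul_star_self _, ?_, vonNeumannEntropy_eq_sum_eigenvalues hρ.1⟩
  have h := hρ.1.conjStarAlgAut_star_eigenvectorUnitary
  rw [Unitary.conjStarAlgAut_apply, Unitary.coe_star, star_star] at h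
  exact h

/-! ### Entropy of ensembles and of bistochastic images -/

theorem ofReal_sum_norm_sq {ι : Type*} [Fintype ι] (f : ι → ℂ) :
    ((∑ i, ‖f i‖ ^ 2 : ℝ) : ℂ) = ∑ i, f i * star (f i) := by
  push_cast
  exact Finset.sum_congr rfl fun i _ => (Complex.mul_conj' (f i)).symm

theorem ofReal_sum_norm_sq' {ι : Type*} [Fintype ι] (f : ι → ℂ) :
    ((∑ i, ‖f i‖ ^ 2 : ℝ) : ℂ) = ∑ i, star (f i) * f i := by
  rw [ofReal_sum_norm_sq]
  exact Finset.sum_congr rfl fun i _ => mul_comm _ _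

/-- The entropy of `W * Wᴴ`, the mixture of the columns of `W`, is at most the Shannon entropy of
the squared norms of these columns. -/
theorem vonNeumannEntropy_mul_conjTranspose_le {m κ : Type*} [Fintype m] [DecidableEq m]
    [Fintype κ] (W : Matrix m κ ℂ) :
    vonNeumannEntropy (W * Wᴴ) ≤ ∑ k, negMulLog (∑ i, ‖W i k‖ ^ 2) := by
  obtain ⟨V, μ, hμ, -, hV', hdiag, hS⟩ :=
    exists_diagonalization (posSemidef_self_mul_conjTranspose W)
  set C : Matrix m κ ℂ := Vᴴ * W with hC
  have hCC : C * Cᴴ = diagonal (fun i => (μ i : ℂ)) := by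
    rw [← hdiag, hC, conjTranspose_mul, conjTranspose_conjTranspose]
    simp only [Matrix.mul_assoc]
  have hCW : Cᴴ * C = Wᴴ * W := by
    rw [hC, conjTranspose_mul, conjTranspose_conjTranspose, Matrix.mul_assoc, ← Matrix.mul_assoc V,
      hV', Matrix.one_mul]
  have hrowC : ∀ a, ∑ k, ‖C a k‖ ^ 2 = μ a := by
    intro a
    have h := congrFun (congrFun hCC a) a
    rw [mul_apply, diagonal_apply_eq] at h
    exact_mod_cast (ofReal_sum_norm_sq (fun k => C a k)).trans h
  have hcolC : ∀ k, ∑ a, ‖C a k‖ ^ 2 = ∑ i, ‖W i k‖ ^ 2 := by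
    intro k
    have h := congrFun (congrFun hCW k) k
    simp only [mul_apply, conjTranspose_apply] at h
    rw [← ofReal_sum_norm_sq', ← ofReal_sum_norm_sq'] at h
    exact_mod_cast h
  have hzero : ∀ a k, μ a = 0 → C a k = 0 := by
    intro a k h
    have h1 := hrowC a
    rw [h, Finset.sum_eq_zero_iff_of_nonneg (fun _ _ => by positivity)] at h1
    simpa using h1 k (Finset.mem_univ k)
  -- `P` is the orthogonal projection onto the range of `Cᴴ`; its diagonal entries are the
  -- row sums of the weights `‖C a k‖ ^ 2 / μ a`.
  set D : Matrix m m ℂ := diagonal (fun i => ((μ i)⁻¹ : ℂ)) with hD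
  set P : Matrix κ κ ℂ := Cᴴ * D * C with hP
  have hDD : D * (diagonal (fun i => (μ i : ℂ))) * D = D := by
    rw [hD, diagonal_mul_diagonal, diagonal_mul_diagonal]
    congr 1
    funext i
    by_cases h : (μ i : ℂ) = 0
    · simp [h]
    · field_simp
  have hDH : Dᴴ = D := by
    rw [hD, diagonal_conjTranspose]
    congr 1
    funext i
    simp
  have hPH : Pᴴ = P := by
    rw [hP]
    simp only [conjTranspose_mul, conjTranspose_conjTranspose, hDH, Matrix.mul_assoc]
  have hPP : P * Pᴴ = P := by
    rw [hPH]
    calc P * P = Cᴴ * (D * (C * Cᴴ) * D) * C := by rw [hP]; simp only [Matrix.mul_assoc]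
      _ = P := by rw [hCC, hDD]
  have hPdiag : ∀ k, P k k = ((∑ a, ‖C a k‖ ^ 2 / μ a : ℝ) : ℂ) := by
    intro k
    rw [hP, mul_apply]
    push_cast
    refine Finset.sum_congr rfl fun a _ => ?_
    rw [hD, mul_diagonal, conjTranspose_apply, ← Complex.conj_mul', div_eq_mul_inv]
    simp only [RCLike.star_def]
    ring
  -- an idempotent Hermitian `P` satisfies `(P k k) ^ 2 ≤ ∑ l, ‖P k l‖ ^ 2 = P k k`
  have hPle : ∀ k, ∑ a, ‖C a k‖ ^ 2 / μ a ≤ 1 := by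
    intro k
    have h := congrFun (congrFun hPP k) k
    rw [mul_apply] at h
    simp only [conjTranspose_apply] at h
    rw [← ofReal_sum_norm_sq, hPdiag k] at h
    have h1 : ∑ l, ‖P k l‖ ^ 2 = ∑ a, ‖C a k‖ ^ 2 / μ a := by exact_mod_cast h
    have h2 : ‖P k k‖ ^ 2 ≤ ∑ l, ‖P k l‖ ^ 2 :=
      Finset.single_le_sum (f := fun l => ‖P k l‖ ^ 2) (fun _ _ => by positivity)
        (Finset.mem_univ k)
    rw [h1, hPdiag k, Complex.norm_real, Real.norm_eq_abs, sq_abs] at h2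
    nlinarith
  rw [hS]
  refine (sum_negMulLog_le_of_substochastic (fun k a => ‖C a k‖ ^ 2 / μ a) μ
    (fun k a => div_nonneg (by positivity) (hμ a)) hμ hPle fun a ha => ?_).trans_eq ?_
  · rw [← Finset.sum_div, hrowC, div_self ha]
  · refine Finset.sum_congr rfl fun k _ => ?_
    rw [← hcolC k]
    congr 1
    refine Finset.sum_congr rfl fun a _ => ?_
    by_cases h : μ a = 0
    · simp [h, hzero a k h]
    · field_simp

/-- A bistochastic operation does not decrease the entropy: in eigenbases of `τ` and of its image, the
spectrum of the image is a doubly stochastic transform of the spectrum of `τ`. -/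
theorem vonNeumannEntropy_le_of_bistochastic {m m' κ : Type*} [Fintype m] [DecidableEq m]
    [Fintype m'] [DecidableEq m'] [Fintype κ] {τ : Matrix m m ℂ} (hτ : τ.PosSemidef)
    (M : κ → Matrix m' m ℂ) (hM : ∑ j, (M j)ᴴ * M j = 1) (hM' : ∑ j, M j * (M j)ᴴ = 1) :
    vonNeumannEntropy τ ≤ vonNeumannEntropy (∑ j, M j * τ * (M j)ᴴ) := by
  obtain ⟨V, l, hl, hV, hV', hdiag, hS⟩ := exists_diagonalization hτ
  obtain ⟨F, s, hs, hF, hF', hdiag', hS'⟩ := exists_diagonalization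
    (posSemidef_sum Finset.univ fun j _ => hτ.mul_mul_conjTranspose_same (M j))
  set N : κ → Matrix m' m ℂ := fun j => Fᴴ * M j * V with hN
  have hNN : ∑ j, (N j)ᴴ * N j = 1 := by
    calc ∑ j, (N j)ᴴ * N j = ∑ j, Vᴴ * ((M j)ᴴ * M j) * V := by
          refine Finset.sum_congr rfl fun j _ => ?_
          calc (N j)ᴴ * N j = Vᴴ * (M j)ᴴ * (F * Fᴴ) * M j * V := by
                simp only [hN, conjTranspose_mul, conjTranspose_conjTranspose, Matrix.mul_assoc]
            _ = _ := by rw [hF']; simp only [Matrix.mul_assoc, Matrix.one_mul]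
      _ = 1 := by rw [← Finset.sum_mul, ← Finset.mul_sum, hM, mul_one, hV]
  have hNN' : ∑ j, N j * (N j)ᴴ = 1 := by
    calc ∑ j, N j * (N j)ᴴ = ∑ j, Fᴴ * (M j * (M j)ᴴ) * F := by
          refine Finset.sum_congr rfl fun j _ => ?_
          calc N j * (N j)ᴴ = Fᴴ * M j * (V * Vᴴ) * (M j)ᴴ * F := by
                simp only [hN, conjTranspose_mul, conjTranspose_conjTranspose, Matrix.mul_assoc]
            _ = _ := by rw [hV']; simp only [Matrix.mul_assoc, Matrix.one_mul]
      _ = 1 := by rw [← Finset.sum_mul, ← Finset.mul_sum, hM', mul_one, hF]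
  have hNs : ∑ j, N j * diagonal (fun i => (l i : ℂ)) * (N j)ᴴ = diagonal fun i => (s i : ℂ) := by
    rw [← hdiag', Finset.mul_sum, Finset.sum_mul]
    refine Finset.sum_congr rfl fun j _ => ?_
    calc N j * diagonal (fun i => (l i : ℂ)) * (N j)ᴴ
        = Fᴴ * M j * (V * Vᴴ) * τ * (V * Vᴴ) * (M j)ᴴ * F := by
          rw [← hdiag]
          simp only [hN, conjTranspose_mul, conjTranspose_conjTranspose, Matrix.mul_assoc]
      _ = _ := by rw [hV']; simp only [Matrix.mul_assoc, Matrix.one_mul]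
  have hrow : ∀ b, ∑ a, ∑ j, ‖N j b a‖ ^ 2 = 1 := by
    intro b
    have h := congrFun (congrFun hNN' b) b
    simp only [Matrix.sum_apply, mul_apply, conjTranspose_apply, one_apply_eq] at h
    simp only [← ofReal_sum_norm_sq] at h
    rw [Finset.sum_comm]
    exact_mod_cast h
  have hcol : ∀ a, ∑ b, ∑ j, ‖N j b a‖ ^ 2 = 1 := by
    intro a
    have h := congrFun (congrFun hNN a) a
    simp only [Matrix.sum_apply, mul_apply, conjTranspose_apply, one_apply_eq] at h
    simp only [← ofReal_sum_norm_sq'] at h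
    rw [Finset.sum_comm]
    exact_mod_cast h
  have heig : ∀ b, ∑ a, (∑ j, ‖N j b a‖ ^ 2) * l a = s b := by
    intro b
    have h := congrFun (congrFun hNs b) b
    rw [Matrix.sum_apply, diagonal_apply_eq] at h
    have h' : ((∑ a, (∑ j, ‖N j b a‖ ^ 2) * l a : ℝ) : ℂ) = (s b : ℂ) := by
      rw [← h]
      push_cast
      simp only [Finset.sum_mul]
      rw [Finset.sum_comm]
      refine Finset.sum_congr rfl fun j _ => ?_
      rw [mul_apply]
      refine Finset.sum_congr rfl fun a _ => ?_
      rw [mul_diagonal, conjTranspose_apply, ← Complex.mul_conj', RCLike.star_def]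
      ring
    exact_mod_cast h'
  rw [hS, hS']
  refine (sum_negMulLog_le_of_substochastic (fun b a => ∑ j, ‖N j b a‖ ^ 2) l
    (fun b a => Finset.sum_nonneg fun _ _ => by positivity) hl (fun b => (hrow b).le)
    fun a _ => hcol a).trans_eq ?_
  exact Finset.sum_congr rfl fun b _ => by rw [heig b]

/-! ### Kraus representations -/

/-- The super-operator `X ↦ ∑ₐ Kₐ X Kₐᴴ` with Kraus operators `Kₐ`. -/
noncomputable def ofKraus {ι α : Type*} [Fintype ι] [Fintype α] (K : α → Matrix ι ι ℂ) :
    SuperOp ι where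
  toFun X := ∑ a, K a * X * (K a)ᴴ
  map_add' X Y := by simp only [Matrix.mul_add, Matrix.add_mul, Finset.sum_add_distrib]
  map_smul' c X := by
    simp only [Matrix.mul_smul, Matrix.smul_mul, Finset.smul_sum, RingHom.id_apply]

theorem ofKraus_apply {ι α : Type*} [Fintype ι] [Fintype α] (K : α → Matrix ι ι ℂ)
    (X : Matrix ι ι ℂ) : ofKraus K X = ∑ a, K a * X * (K a)ᴴ := rfl

theorem ofKraus_one {ι : Type*} [Fintype ι] [DecidableEq ι] :
    ofKraus (fun _ : Unit => (1 : Matrix ι ι ℂ)) = LinearMap.id := by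
  ext1 X
  simp [ofKraus_apply]

theorem tensor_ofKraus {ι κ α β : Type*} [Fintype ι] [DecidableEq ι] [Fintype κ] [DecidableEq κ]
    [Fintype α] [Fintype β] (K : α → Matrix ι ι ℂ) (L : β → Matrix κ κ ℂ) :
    tensor (ofKraus K) (ofKraus L) = ofKraus (fun p : α × β => K p.1 ⊗ₖ L p.2) := by
  refine Matrix.ext_linearMap ℂ fun ⟨i, k⟩ ⟨j, l⟩ => ?_
  ext1
  have h : single (i, k) (j, l) (1 : ℂ) = single i j 1 ⊗ₖ single k l 1 := by
    rw [single_kronecker_single, one_mul]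
  simp only [LinearMap.comp_apply, singleLinearMap_apply]
  rw [h, tensor_kronecker]
  simp only [ofKraus_apply]
  rw [Fintype.sum_prod_type]
  simp only [conjTranspose_kronecker, ← mul_kronecker_mul]
  ext ⟨a, b⟩ ⟨c, d⟩
  simp only [kroneckerMap_apply, Matrix.sum_apply, Finset.sum_mul_sum]

theorem sum_conjTranspose_mul_of_trace_preserving {ι α : Type*} [Fintype ι] [DecidableEq ι]
    [Fintype α] {K : α → Matrix ι ι ℂ} (h : ∀ X, (ofKraus K X).trace = X.trace) :
    ∑ a, (K a)ᴴ * K a = 1 := by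
  refine Matrix.ext_iff_trace_mul_left.2 fun X => ?_
  rw [mul_one, ← h X, ofKraus_apply, Finset.mul_sum, trace_sum, trace_sum]
  refine Finset.sum_congr rfl fun a _ => ?_
  rw [← Matrix.mul_assoc, trace_mul_comm, ← Matrix.mul_assoc]

theorem mul_ketbra_mul_conjTranspose {ι κ : Type*} [Fintype ι] (M : Matrix κ ι ℂ) (ψ : ι → ℂ) :
    M * ketbra ψ * Mᴴ = ketbra (M *ᵥ ψ) := by
  rw [ketbra, ketbra, mul_vecMulVec, vecMulVec_mul, star_mulVec]

/-- The analogue of `Matrix.kronecker_mulVec_vec` for the row-stacking vectorization `QOp.vec`, whereas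
`Matrix.vec` stacks columns. -/
theorem kronecker_mulVec_vec_row {ι κ : Type*} [Fintype ι] [Fintype κ]
    (A : Matrix ι ι ℂ) (B : Matrix κ κ ℂ) (X : Matrix ι κ ℂ) :
    (A ⊗ₖ B) *ᵥ vec X = vec (A * X * Bᵀ) := by
  have h : vec (A * X * Bᵀ) = Matrix.vec (B * Xᵀ * Aᵀ) := by
    change Matrix.vec (A * X * Bᵀ)ᵀ = _
    simp only [transpose_mul, transpose_transpose, Matrix.mul_assoc]
  rw [h]
  exact kronecker_mulVec_vec B Xᵀ A

theorem tensor_ofKraus_ketbra_vec {ι κ α β : Type*} [Fintype ι] [DecidableEq ι] [Fintype κ]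
    [DecidableEq κ] [Fintype α] [Fintype β] (K : α → Matrix ι ι ℂ) (L : β → Matrix κ κ ℂ)
    (X : Matrix ι κ ℂ) :
    tensor (ofKraus K) (ofKraus L) (ketbra (vec X)) =
      ∑ p : α × β, ketbra (vec (K p.1 * X * (L p.2)ᵀ)) := by
  rw [tensor_ofKraus, ofKraus_apply]
  simp only [mul_ketbra_mul_conjTranspose, kronecker_mulVec_vec_row]

theorem dynamicalMatrix_ofKraus {n : ℕ} {α : Type*} [Fintype α]
    (K : α → Matrix (Fin n) (Fin n) ℂ) :
    dynamicalMatrix (ofKraus K) = ∑ a, ketbra (vec (K a)) := by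
  rw [dynamicalMatrix, ← ofKraus_one, tensor_ofKraus_ketbra_vec, Fintype.sum_prod_type]
  simp

theorem dynamicalMatrix_apply {n : ℕ} (Φ : SuperOp (Fin n)) (p q r s : Fin n) :
    dynamicalMatrix Φ (p, q) (r, s) = Φ (single q s 1) p r := by
  simp [dynamicalMatrix, tensor, ketbra, vec, vecMulVec_apply, Matrix.sum_apply, one_apply,
    single_apply, ite_and, Finset.sum_ite_eq, apply_ite]

theorem posSemidef_inv_smul_dynamicalMatrix {n : ℕ} {Φ : SuperOp (Fin n)} (hΦ : IsCP Φ) :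
    ((n : ℂ)⁻¹ • dynamicalMatrix Φ).PosSemidef :=
  (hΦ n _ (posSemidef_vecMulVec_self_star _)).smul (by positivity)

/-- Canonical Kraus operators, read off from the spectral decomposition of the dynamical matrix:
their squared Hilbert-Schmidt norms, divided by `n`, are the eigenvalues that determine the map
entropy. -/
theorem exists_kraus {n : ℕ} (hn : n ≠ 0) {Φ : SuperOp (Fin n)} (hΦ : IsCP Φ) :
    ∃ K : Fin n × Fin n → Matrix (Fin n) (Fin n) ℂ, Φ = ofKraus K ∧
      mapEntropy Φ = ∑ a, negMulLog ((n : ℝ)⁻¹ * ∑ p, ‖vec (K a) p‖ ^ 2) := by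
  obtain ⟨V, μ, hμ, hV, hV', hdiag, hS⟩ := exists_diagonalization (posSemidef_inv_smul_dynamicalMatrix hΦ)
  have hn' : (n : ℂ) ≠ 0 := by exact_mod_cast hn
  have hn'' : (n : ℝ) ≠ 0 := by exact_mod_cast hn
  have hJ : dynamicalMatrix Φ = (n : ℂ) • (V * diagonal (fun i => (μ i : ℂ)) * Vᴴ) := by
    rw [← hdiag]
    calc dynamicalMatrix Φ = (n : ℂ) • ((n : ℂ)⁻¹ • dynamicalMatrix Φ) := by
          rw [smul_smul, mul_inv_cancel₀ hn', one_smul]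
      _ = (n : ℂ) • ((V * Vᴴ) * ((n : ℂ)⁻¹ • dynamicalMatrix Φ) * (V * Vᴴ)) := by
          rw [hV', Matrix.one_mul, Matrix.mul_one]
      _ = _ := by simp only [Matrix.mul_assoc]
  refine ⟨fun a => Matrix.of fun p q => ((√(n * μ a) : ℝ) : ℂ) * V (p, q) a, ?_, ?_⟩
  · have hsq : ∀ a, ((√(n * μ a) : ℝ) : ℂ) * ((√(n * μ a) : ℝ) : ℂ) = n * μ a := by
      intro a
      rw [← Complex.ofReal_mul, mul_self_sqrt (mul_nonneg (Nat.cast_nonneg n) (hμ a))]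
      push_cast
      rfl
    refine Matrix.ext_linearMap ℂ fun q s => ?_
    ext1
    simp only [LinearMap.comp_apply, singleLinearMap_apply]
    ext p r
    rw [← dynamicalMatrix_apply, hJ, ofKraus_apply, Matrix.sum_apply, Matrix.smul_apply, mul_apply,
      smul_eq_mul, Finset.mul_sum]
    refine Finset.sum_congr rfl fun a _ => ?_
    rw [mul_diagonal, mul_apply, Finset.sum_eq_single s]
    · rw [mul_single_apply_same]
      simp only [conjTranspose_apply, of_apply, star_mul', RCLike.star_def, Complex.conj_ofReal]
      linear_combination -(V (p, q) a * (starRingEnd ℂ) (V (r, s) a)) * hsq a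
    · intro t _ ht
      rw [mul_single_apply_of_ne _ _ _ _ _ ht, zero_mul]
    · simp
  · rw [mapEntropy, hS]
    refine Finset.sum_congr rfl fun a _ => ?_
    congr 1
    have hcol : ∑ p, ‖V p a‖ ^ 2 = 1 := by
      have h := congrFun (congrFun hV a) a
      rw [mul_apply, one_apply_eq] at h
      exact_mod_cast (ofReal_sum_norm_sq' (fun p => V p a)).trans h
    have hw : ∀ p : Fin n × Fin n,
        ‖((√(n * μ a) : ℝ) : ℂ) * V p a‖ ^ 2 = n * μ a * ‖V p a‖ ^ 2 := by
      intro p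
      rw [norm_mul, mul_pow, Complex.norm_real, Real.norm_eq_abs, sq_abs,
        sq_sqrt (mul_nonneg (Nat.cast_nonneg n) (hμ a))]
    simp only [vec, of_apply, hw]
    rw [← Finset.mul_sum, hcol]
    field_simp

/-! ### Hilbert-Schmidt norms -/

theorem ofReal_sum_norm_sq_vec {ι κ : Type*} [Fintype ι] [Fintype κ] (A : Matrix ι κ ℂ) :
    ((∑ p, ‖vec A p‖ ^ 2 : ℝ) : ℂ) = (A * Aᴴ).trace := by
  rw [ofReal_sum_norm_sq, Fintype.sum_prod_type]
  rfl

theorem sum_norm_sq_vec_transpose {ι κ : Type*} [Fintype ι] [Fintype κ] (A : Matrix ι κ ℂ) :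
    ∑ p, ‖vec Aᵀ p‖ ^ 2 = ∑ p, ‖vec A p‖ ^ 2 := by
  rw [Fintype.sum_prod_type, Fintype.sum_prod_type, Finset.sum_comm]
  rfl

/-- The Kraus identity `∑ Lᵦᴴ Lᵦ = 1` as conservation of the Hilbert-Schmidt norm. It is used for Kraus
operators of a trace preserving map, and for a family consisting of one unitary. -/
theorem sum_norm_sq_vec_mul_transpose {ι κ β : Type*} [Fintype ι] [Fintype κ] [DecidableEq κ]
    [Fintype β] {L : β → Matrix κ κ ℂ} (hL : ∑ b, (L b)ᴴ * L b = 1) (A : Matrix ι κ ℂ) :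
    ∑ b, ∑ p, ‖vec (A * (L b)ᵀ) p‖ ^ 2 = ∑ p, ‖vec A p‖ ^ 2 := by
  have hLT : ∑ b, (L b)ᵀ * ((L b)ᵀ)ᴴ = 1 := by
    have h := congrArg transpose hL
    rw [transpose_sum, transpose_one] at h
    rw [← h]
    refine Finset.sum_congr rfl fun b _ => ?_
    rw [transpose_mul]
    rfl
  have h : ((∑ b, ∑ p, ‖vec (A * (L b)ᵀ) p‖ ^ 2 : ℝ) : ℂ) = ((∑ p, ‖vec A p‖ ^ 2 : ℝ) : ℂ) := by
    rw [Complex.ofReal_sum]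
    simp only [ofReal_sum_norm_sq_vec]
    calc ∑ b, (A * (L b)ᵀ * (A * (L b)ᵀ)ᴴ).trace
        = ∑ b, (A * ((L b)ᵀ * ((L b)ᵀ)ᴴ) * Aᴴ).trace := by
          simp only [conjTranspose_mul, Matrix.mul_assoc]
      _ = (A * (∑ b, (L b)ᵀ * ((L b)ᵀ)ᴴ) * Aᴴ).trace := by
          rw [← trace_sum, Matrix.mul_sum, Matrix.sum_mul]
      _ = _ := by rw [hLT, Matrix.mul_one]
  exact_mod_cast h

/-! ### The output of a maximally entangled state -/

theorem inv_sqrt_mul_inv_sqrt (n : ℕ) :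
    ((√n : ℝ) : ℂ)⁻¹ * ((√n : ℝ) : ℂ)⁻¹ = (n : ℂ)⁻¹ := by
  rw [← mul_inv, ← Complex.ofReal_mul, mul_self_sqrt (Nat.cast_nonneg n), Complex.ofReal_natCast]

theorem ketbra_maxEntangled {n : ℕ} (U : Matrix (Fin n) (Fin n) ℂ) :
    ketbra (maxEntangled U) = (n : ℂ)⁻¹ • ketbra (vec U) := by
  ext p q
  have h := inv_sqrt_mul_inv_sqrt n
  simp only [ketbra, maxEntangled, vecMulVec_apply, Matrix.smul_apply, Pi.smul_apply, Pi.star_apply,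
    smul_eq_mul, star_mul', star_inv₀, RCLike.star_def, Complex.conj_ofReal, ← h]
  ring

/-- The entropy of a mixture of pure states is at most the Shannon entropy of the mixing weights; the
vectors `w k` are unnormalized and carry the weights. -/
theorem vonNeumannEntropy_sum_smul_ketbra_le {m κ : Type*} [Fintype m] [DecidableEq m] [Fintype κ]
    (n : ℕ) (w : κ → m → ℂ) :
    vonNeumannEntropy ((n : ℂ)⁻¹ • ∑ k, ketbra (w k)) ≤
      ∑ k, negMulLog ((n : ℝ)⁻¹ * ∑ i, ‖w k i‖ ^ 2) := by
  set W : Matrix m κ ℂ := Matrix.of fun i k => ((√n : ℝ) : ℂ)⁻¹ * w k i with hW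
  have h := inv_sqrt_mul_inv_sqrt n
  have hWW : (n : ℂ)⁻¹ • ∑ k, ketbra (w k) = W * Wᴴ := by
    ext i j
    rw [Matrix.smul_apply, Matrix.sum_apply, mul_apply, smul_eq_mul, Finset.mul_sum]
    refine Finset.sum_congr rfl fun k _ => ?_
    simp only [hW, ketbra, vecMulVec_apply, conjTranspose_apply, of_apply, Pi.star_apply, star_mul',
      star_inv₀, RCLike.star_def, Complex.conj_ofReal, ← h]
    ring
  rw [hWW]
  refine (vonNeumannEntropy_mul_conjTranspose_le W).trans_eq ?_
  refine Finset.sum_congr rfl fun k _ => ?_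
  congr 1
  rw [Finset.mul_sum]
  refine Finset.sum_congr rfl fun i _ => ?_
  rw [hW, of_apply, norm_mul, mul_pow, norm_inv, Complex.norm_real, norm_eq_abs, abs_of_nonneg
    (sqrt_nonneg _), inv_pow, sq_sqrt (Nat.cast_nonneg n)]

theorem sum_one_kronecker {ι κ β : Type*} [DecidableEq ι] [DecidableEq κ] [Fintype β]
    {M : β → Matrix κ κ ℂ} (hM : ∑ b, M b = 1) :
    ∑ b, (1 : Matrix ι ι ℂ) ⊗ₖ M b = 1 := by
  rw [← one_kronecker_one, ← hM]
  ext ⟨i, k⟩ ⟨j, l⟩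
  simp only [Matrix.sum_apply, kroneckerMap_apply, Finset.mul_sum]

/-- With Kraus operators `Lᵦ` of `Ψ`, the output state arises from the Jamiołkowski state of `Φ` by
the bistochastic operation with Kraus operators `1 ⊗ Lᵦ Uᵀ`, which can only increase the entropy. -/
theorem mapEntropy_le_vonNeumannEntropy_tensor {n : ℕ} {Φ Ψ : SuperOp (Fin n)}
    (hΦ : IsBistochastic Φ) (hΨ : IsBistochastic Ψ) {U : Matrix (Fin n) (Fin n) ℂ}
    (hU : Uᴴ * U = 1) (hU' : U * Uᴴ = 1) :
    mapEntropy Φ ≤ vonNeumannEntropy ((n : ℂ)⁻¹ • tensor Φ Ψ (ketbra (vec U))) := by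
  rcases Nat.eq_zero_or_pos n with rfl | hn
  · simp [mapEntropy, vonNeumannEntropy, Matrix.trace]
  have hpsd := posSemidef_inv_smul_dynamicalMatrix hΦ.isCP
  obtain ⟨K, rfl, -⟩ := exists_kraus hn.ne' hΦ.isCP
  obtain ⟨L, rfl, -⟩ := exists_kraus hn.ne' hΨ.isCP
  have hL := sum_conjTranspose_mul_of_trace_preserving hΨ.trace_preserving
  have hL' : ∑ b, L b * (L b)ᴴ = 1 := by simpa [ofKraus_apply] using hΨ.unital
  have hUT : Uᵀ * (Uᵀ)ᴴ = 1 := by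
    rw [← transpose_one, ← hU, transpose_mul]
    rfl
  have hUT' : (Uᵀ)ᴴ * Uᵀ = 1 := by
    rw [← transpose_one, ← hU', transpose_mul]
    rfl
  have hσ : (n : ℂ)⁻¹ • tensor (ofKraus K) (ofKraus L) (ketbra (vec U)) =
      ∑ b, ((1 : Matrix (Fin n) (Fin n) ℂ) ⊗ₖ (L b * Uᵀ)) *
        ((n : ℂ)⁻¹ • dynamicalMatrix (ofKraus K)) *
        ((1 : Matrix (Fin n) (Fin n) ℂ) ⊗ₖ (L b * Uᵀ))ᴴ := by
    rw [tensor_ofKraus_ketbra_vec, dynamicalMatrix_ofKraus, Fintype.sum_prod_type_right,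
      Finset.smul_sum]
    refine Finset.sum_congr rfl fun b _ => ?_
    rw [Matrix.mul_smul, Matrix.smul_mul, Matrix.mul_sum, Matrix.sum_mul]
    congr 1
    refine Finset.sum_congr rfl fun a _ => ?_
    rw [mul_ketbra_mul_conjTranspose, kronecker_mulVec_vec_row, Matrix.one_mul, transpose_mul,
      transpose_transpose, Matrix.mul_assoc]
  rw [hσ]
  refine vonNeumannEntropy_le_of_bistochastic hpsd _ ?_ ?_
  · simp only [conjTranspose_kronecker, ← mul_kronecker_mul, conjTranspose_one, Matrix.one_mul]
    refine sum_one_kronecker ?_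
    calc ∑ b, (L b * Uᵀ)ᴴ * (L b * Uᵀ) = ∑ b, (Uᵀ)ᴴ * ((L b)ᴴ * L b) * Uᵀ := by
          simp only [conjTranspose_mul, Matrix.mul_assoc]
      _ = 1 := by rw [← Matrix.sum_mul, ← Matrix.mul_sum, hL, Matrix.mul_one, hUT']
  · simp only [conjTranspose_kronecker, ← mul_kronecker_mul, conjTranspose_one, Matrix.one_mul]
    refine sum_one_kronecker ?_
    calc ∑ b, L b * Uᵀ * (L b * Uᵀ)ᴴ = ∑ b, L b * (Uᵀ * (Uᵀ)ᴴ) * (L b)ᴴ := by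
          simp only [conjTranspose_mul, Matrix.mul_assoc]
      _ = 1 := by simp only [hUT, Matrix.mul_one, hL']

/-- Exchanging the two tensor factors transposes `U`. Only one inequality is recorded, since the
other one is the same statement with the roles of `Φ` and `Ψ` exchanged. -/
theorem vonNeumannEntropy_tensor_swap_le {n : ℕ} {Φ Ψ : SuperOp (Fin n)}
    (hΦ : IsBistochastic Φ) (hΨ : IsBistochastic Ψ) (U : Matrix (Fin n) (Fin n) ℂ) :
    vonNeumannEntropy ((n : ℂ)⁻¹ • tensor Ψ Φ (ketbra (vec Uᵀ))) ≤
      vonNeumannEntropy ((n : ℂ)⁻¹ • tensor Φ Ψ (ketbra (vec U))) := by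
  rcases Nat.eq_zero_or_pos n with rfl | hn
  · simp [vonNeumannEntropy, Matrix.trace]
  obtain ⟨K, rfl, -⟩ := exists_kraus hn.ne' hΦ.isCP
  obtain ⟨L, rfl, -⟩ := exists_kraus hn.ne' hΨ.isCP
  set P : Matrix (Fin n × Fin n) (Fin n × Fin n) ℂ :=
    Equiv.Perm.permMatrix ℂ (Equiv.prodComm (Fin n) (Fin n)) with hP
  have hvec : ∀ A : Matrix (Fin n) (Fin n) ℂ, P *ᵥ vec A = vec Aᵀ := by
    intro A
    rw [hP, permMatrix_mulVec]
    rfl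
  have hP1 : P * P = 1 := by
    rw [hP, ← permMatrix_mul]
    exact permMatrix_refl
  have hPH : Pᴴ = P := by
    rw [hP, conjTranspose_permMatrix]
    rfl
  have hpsd : ((n : ℂ)⁻¹ • tensor (ofKraus L) (ofKraus K) (ketbra (vec Uᵀ))).PosSemidef := by
    rw [tensor_ofKraus_ketbra_vec]
    exact (posSemidef_sum _ fun _ _ => posSemidef_vecMulVec_self_star _).smul (by positivity)
  have hσ : (n : ℂ)⁻¹ • tensor (ofKraus K) (ofKraus L) (ketbra (vec U)) =
      ∑ _j : Unit, P * ((n : ℂ)⁻¹ • tensor (ofKraus L) (ofKraus K) (ketbra (vec Uᵀ))) * Pᴴ := by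
    rw [Fintype.sum_unique, tensor_ofKraus_ketbra_vec, tensor_ofKraus_ketbra_vec,
      Matrix.mul_smul, Matrix.smul_mul, Matrix.mul_sum, Matrix.sum_mul]
    congr 1
    refine Fintype.sum_equiv (Equiv.prodComm _ _) _ _ fun q => ?_
    rw [mul_ketbra_mul_conjTranspose, hvec]
    simp only [Equiv.prodComm_apply, Prod.fst_swap, Prod.snd_swap, transpose_mul,
      transpose_transpose, Matrix.mul_assoc]
  rw [hσ]
  exact vonNeumannEntropy_le_of_bistochastic hpsd (fun _ => P) (by simp [hPH, hP1])
    (by simp [hPH, hP1])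

/-- With canonical Kraus operators, the squared norms of the vectors `vec (Kₐ U Lᵦᵀ) / √n` form a
joint distribution whose marginals are the spectra of the two Jamiołkowski states. -/
theorem vonNeumannEntropy_tensor_le {n : ℕ} {Φ Ψ : SuperOp (Fin n)}
    (hΦ : IsBistochastic Φ) (hΨ : IsBistochastic Ψ) {U : Matrix (Fin n) (Fin n) ℂ}
    (hU : Uᴴ * U = 1) (hU' : U * Uᴴ = 1) :
    vonNeumannEntropy ((n : ℂ)⁻¹ • tensor Φ Ψ (ketbra (vec U))) ≤
      mapEntropy Φ + mapEntropy Ψ := by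
  rcases Nat.eq_zero_or_pos n with rfl | hn
  · simp [mapEntropy, vonNeumannEntropy, Matrix.trace]
  have hn' : (n : ℝ) ≠ 0 := by exact_mod_cast hn.ne'
  obtain ⟨K, rfl, hSK⟩ := exists_kraus hn.ne' hΦ.isCP
  obtain ⟨L, rfl, hSL⟩ := exists_kraus hn.ne' hΨ.isCP
  have hK := sum_conjTranspose_mul_of_trace_preserving hΦ.trace_preserving
  have hL := sum_conjTranspose_mul_of_trace_preserving hΨ.trace_preserving
  have hUT : (Uᵀ)ᴴ * Uᵀ = 1 := by
    rw [← transpose_one, ← hU', transpose_mul]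
    rfl
  -- unitary invariance of the Hilbert-Schmidt norm, as one-term instances of the Kraus identity
  have hnormU : ∀ A : Matrix (Fin n) (Fin n) ℂ, ∑ p, ‖vec (A * U) p‖ ^ 2 = ∑ p, ‖vec A p‖ ^ 2 := by
    intro A
    simpa using sum_norm_sq_vec_mul_transpose (L := fun _ : Unit => Uᵀ) (by simpa using hUT) A
  have hnormUT : ∀ A : Matrix (Fin n) (Fin n) ℂ,
      ∑ p, ‖vec (A * Uᵀ) p‖ ^ 2 = ∑ p, ‖vec A p‖ ^ 2 := by
    intro A
    simpa using sum_norm_sq_vec_mul_transpose (L := fun _ : Unit => U) (by simpa using hU) A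
  set p : Fin n × Fin n → Fin n × Fin n → ℝ :=
    fun a b => (n : ℝ)⁻¹ * ∑ i, ‖vec (K a * U * (L b)ᵀ) i‖ ^ 2 with hp
  have hrow : ∀ a, ∑ b, p a b = (n : ℝ)⁻¹ * ∑ i, ‖vec (K a) i‖ ^ 2 := by
    intro a
    rw [hp, ← Finset.mul_sum, sum_norm_sq_vec_mul_transpose hL, hnormU]
  have hcol : ∀ b, ∑ a, p a b = (n : ℝ)⁻¹ * ∑ i, ‖vec (L b) i‖ ^ 2 := by
    intro b
    have h : ∀ a, ∑ i, ‖vec (K a * U * (L b)ᵀ) i‖ ^ 2 =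
        ∑ i, ‖vec (L b * Uᵀ * (K a)ᵀ) i‖ ^ 2 := by
      intro a
      rw [← sum_norm_sq_vec_transpose]
      simp only [transpose_mul, transpose_transpose, Matrix.mul_assoc]
    simp only [hp, h]
    rw [← Finset.mul_sum, sum_norm_sq_vec_mul_transpose hK, hnormUT]
  have htotal : ∑ a, ∑ b, p a b = 1 := by
    simp only [hrow]
    have h := sum_norm_sq_vec_mul_transpose hK (1 : Matrix (Fin n) (Fin n) ℂ)
    simp only [Matrix.one_mul, sum_norm_sq_vec_transpose] at h
    have h1 : ∑ i, ‖vec (1 : Matrix (Fin n) (Fin n) ℂ) i‖ ^ 2 = (n : ℝ) := by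
      have := ofReal_sum_norm_sq_vec (1 : Matrix (Fin n) (Fin n) ℂ)
      rw [conjTranspose_one, Matrix.one_mul, trace_one, Fintype.card_fin] at this
      exact_mod_cast this
    rw [← Finset.mul_sum, h, h1, inv_mul_cancel₀ hn']
  rw [tensor_ofKraus_ketbra_vec, hSK, hSL]
  refine (vonNeumannEntropy_sum_smul_ketbra_le n _).trans ?_
  rw [Fintype.sum_prod_type]
  refine (sum_negMulLog_le_add_marginals p (fun a b => by positivity) htotal).trans_eq ?_
  simp only [hrow, hcol]

end QOp

theorem mainTheorem3 {n : ℕ} (Φ Ψ : QOp.SuperOp (Fin n))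
    (hΦ : QOp.IsBistochastic Φ) (hΨ : QOp.IsBistochastic Ψ)
    (U : Matrix (Fin n) (Fin n) ℂ) (hU : U ∈ Matrix.unitaryGroup (Fin n) ℂ) :
    max (QOp.mapEntropy Φ) (QOp.mapEntropy Ψ)
        ≤ QOp.vonNeumannEntropy (QOp.tensor Φ Ψ (QOp.ketbra (QOp.maxEntangled U))) ∧
      QOp.vonNeumannEntropy (QOp.tensor Φ Ψ (QOp.ketbra (QOp.maxEntangled U)))
        ≤ QOp.mapEntropy Φ + QOp.mapEntropy Ψ := by
  have h1 : U.conjTranspose * U = 1 := Matrix.mem_unitaryGroup_iff'.1 hU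
  have h2 : U * U.conjTranspose = 1 := Matrix.mem_unitaryGroup_iff.1 hU
  have h3 : U.transpose.conjTranspose * U.transpose = 1 := by
    rw [← Matrix.transpose_one, ← h2, Matrix.transpose_mul]
    rfl
  have h4 : U.transpose * U.transpose.conjTranspose = 1 := by
    rw [← Matrix.transpose_one, ← h1, Matrix.transpose_mul]
    rfl
  rw [QOp.ketbra_maxEntangled, map_smul]
  exact ⟨max_le (QOp.mapEntropy_le_vonNeumannEntropy_tensor hΦ hΨ h1 h2)
    ((QOp.mapEntropy_le_vonNeumannEntropy_tensor hΨ hΦ h3 h4).trans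
      (QOp.vonNeumannEntropy_tensor_swap_le hΦ hΨ U)),
    QOp.vonNeumannEntropy_tensor_le hΦ hΨ h1 h2⟩
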